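/- Let $n\ge 2$, let $\Omega\subset\mathbb{R}^n$ be a bounded domain (a nonempty bounded connected open set), and write $\rho(x)=\mathrm{dist}(x,\partial\Omega)=\mathrm{dist}(x,\mathbb{R}^n\setminus\Omega)$ for $x\in\Omega$. Let $(p,q,b)$ be a Sobolev triple, i.e. real numbers with $$1\le p\le q<\infty,\qquad \frac nq+1-\frac np\ge 0,\qquad b=p\Big(\frac nq+1-\frac np\Big).$$ Suppose that $\Omega$ supports the $(P_{p,q,b})$-Poincaré inequality with constant $C_0>0$: for every $u\in C^\infty(\Omega)\cap L^1(\Omega)$, with $u_\Omega=\frac1{|\Omega|}\int_\Omega u\,dx$, $$\Big(\int_\Omega|u(x)-u_\Omega|^q\,dx\Big)^{p/q}\le C_0\int_\Omega|\nabla u(x)|^p\rho(x)^b\,dx,$$ where both sides are allowed to be infinite. Fix an open ball $B_0\subset\Omega$ of positive radius. Then there exists a constant $C=C(C_0,n,p,q,\Omega,B_0)>0$ such that for all $w\in\Omega$ and all $d>0$, $$\mathrm{diam}(T)\le C\,d$$ whenever $T$ is a connected component of $\Omega\setminus B(w,d)$ with $T\cap B_0=\emptyset$, where $B(w,d)$ is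 the open ball of centre $w$ and radius $d$. -/

import Mathlib

open MeasureTheory Metric Set
open scoped ENNReal ContDiff Gradient

namespace WeightedPoincare

/-- A bounded domain in `ℝⁿ`: a nonempty, bounded, open, connected set. -/
structure IsBoundedDomain {n : ℕ} (Ω : Set (EuclideanSpace ℝ (Fin n))) : Prop where
  isOpen : IsOpen Ω
  isConnected : IsConnected Ω
  isBounded : Bornology.IsBounded Ω

/-- `(p, q, b)` is a Sobolev triple in dimension `n`:
`1 ≤ p ≤ q < ∞`, `n / q + 1 - n / p ≥ 0` and `b = p (n / q + 1 - n / p)`. -/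
structure IsSobolevTriple (n : ℕ) (p q b : ℝ) : Prop where
  one_le : 1 ≤ p
  le : p ≤ q
  nonneg : 0 ≤ (n : ℝ) / q + 1 - (n : ℝ) / p
  eq : b = p * ((n : ℝ) / q + 1 - (n : ℝ) / p)

/-- The distance `ρ(x)` from `x` to the complement of `Ω`; for `x` in a bounded domain `Ω`
this is the distance from `x` to the boundary of `Ω`. -/
noncomputable def rho {n : ℕ} (Ω : Set (EuclideanSpace ℝ (Fin n)))
    (x : EuclideanSpace ℝ (Fin n)) : ℝ :=
  infDist x Ωᶜ

/-- The `(P_{p,q,b})`-Poincaré inequality on `Ω` with constant `C₀`: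
`(∫_Ω |u - u_Ω|^q)^{p/q} ≤ C₀ ∫_Ω |∇u|^p ρ^b` for every `u ∈ C^∞(Ω)` whose integral average
`u_Ω` over `Ω` makes sense. Both sides take values in `[0, ∞]`. -/
def PoincareInequality {n : ℕ} (Ω : Set (EuclideanSpace ℝ (Fin n))) (p q b C₀ : ℝ) : Prop :=
  ∀ u : EuclideanSpace ℝ (Fin n) → ℝ, ContDiffOn ℝ ∞ u Ω → IntegrableOn u Ω volume →
    (∫⁻ x in Ω, ‖u x - ⨍ y in Ω, u y‖ₑ ^ q) ^ (p / q) ≤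
      ENNReal.ofReal C₀ * ∫⁻ x in Ω, ‖∇ u x‖ₑ ^ p * ENNReal.ofReal (rho Ω x ^ b)

/-- `T` is a connected component of the set `S`. -/
def IsComponentOf {X : Type*} [TopologicalSpace X] (T S : Set X) : Prop :=
  ∃ x ∈ S, T = connectedComponentIn S x

end WeightedPoincare

namespace WeightedPoincare

/-! Test the Poincaré inequality on a radial cutoff around `w`, multiplied by the indicator of `T`.
This is smooth on `Ω`, because away from the closed ball `T` is locally all or nothing. It vanishes
on the fixed ball and is `1` far out in `T`, so `exists_capacity_estimate` bounds the measure of a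
tail of `T` by that of an annular piece of `T`, with weight `s ^ (-p) * M ^ b`, where `s` is the
width and `M` bounds `ρ` on the piece.

Let `g t` be the radius of a ball with the volume of the tail beyond `t`. Past `t + g t` one has `ρ
≤ g t`, since otherwise the tail would contain too large a ball (`rho_le_tailRadius`). The choice `M
= g t`, `s = A * g t` is scale invariant because `-p + b + n = n p / q`, and a large `A` makes `g`
halve. The steps are proportional to `g`, so their lengths sum geometrically and `g` vanishes at
distance `O(d + g (2 d))`; an open null tail is empty.

To start, `g (2 d) ≤ G d` follows from the same estimate once `ρ w ≤ d`; `rho_center_le` gives this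
for `d < r₀`. For `d ≥ r₀` boundedness of `Ω` suffices. -/

/-- Halving along steps proportional to the value forces a zero at a controlled time. -/
theorem eq_zero_of_halving {g : ℝ → ℝ} (hg : Antitone g) (hg0 : ∀ t, 0 ≤ g t) {K t₀ : ℝ}
    (hK : 0 ≤ K) (h : ∀ t, t₀ ≤ t → g (t + K * g t) ≤ g t / 2) :
    g (t₀ + 2 * K * g t₀) = 0 := by
  have key : ∀ k : ℕ, ∃ t, t₀ ≤ t ∧ t + 2 * K * g t ≤ t₀ + 2 * K * g t₀ ∧
      g t ≤ g t₀ * (1 / 2) ^ k := by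
    intro k
    induction k with
    | zero => exact ⟨t₀, le_rfl, le_rfl, by simp⟩
    | succ k ih =>
      obtain ⟨t, h1, h2, h3⟩ := ih
      have h4 := h t h1
      refine ⟨t + K * g t, ?_, ?_, ?_⟩
      · have := mul_nonneg hK (hg0 t); linarith
      -- `t + 2 * K * g t` never increases: a step adds `K * g t` to `t`, and the halving removes at
      -- least that much.
      · nlinarith [mul_le_mul_of_nonneg_left h4 hK]
      · rw [pow_succ]; linarith
  refine le_antisymm ?_ (hg0 _)
  refine ge_of_tendsto' (x := Filter.atTop) (f := fun k : ℕ => g t₀ * (1 / 2) ^ k) ?_ ?_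
  · have := (tendsto_pow_atTop_nhds_zero_of_lt_one (r := (1 / 2 : ℝ)) (by norm_num)
      (by norm_num)).const_mul (g t₀)
    simpa using this
  · intro k
    obtain ⟨t, -, h2, h3⟩ := key k
    refine le_trans (hg ?_) h3
    have := mul_nonneg (mul_nonneg zero_le_two hK) (hg0 t)
    linarith

theorem exists_lipschitzWith_smoothTransition :
    ∃ L : NNReal, LipschitzWith L Real.smoothTransition := by
  have hc : Continuous (deriv Real.smoothTransition) :=
    Real.smoothTransition.contDiff.continuous_deriv (n := 1) le_rfl
  obtain ⟨L, hL⟩ := (isCompact_Icc (a := (0 : ℝ)) (b := 1)).exists_bound_of_continuousOn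
    hc.continuousOn
  have hL0 : 0 ≤ L := (norm_nonneg _).trans (hL 0 (by simp))
  refine ⟨L.toNNReal, lipschitzWith_of_nnnorm_deriv_le
    (Real.smoothTransition.contDiff.differentiable (n := 1) one_ne_zero) fun x => ?_⟩
  rw [← NNReal.coe_le_coe]
  rw [coe_nnnorm, Real.coe_toNNReal _ hL0]
  by_cases h0 : x < 0
  · have : Real.smoothTransition =ᶠ[nhds x] fun _ => (0 : ℝ) := by
      filter_upwards [Iio_mem_nhds h0] with y hy
      exact Real.smoothTransition.zero_of_nonpos (le_of_lt hy)
    rw [this.deriv_eq]; simpa using hL0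
  by_cases h1 : 1 < x
  · have : Real.smoothTransition =ᶠ[nhds x] fun _ => (1 : ℝ) := by
      filter_upwards [Ioi_mem_nhds h1] with y hy
      exact Real.smoothTransition.one_of_one_le (le_of_lt hy)
    rw [this.deriv_eq]; simpa using hL0
  · exact hL x ⟨not_lt.1 h0, not_lt.1 h1⟩

/-! ### Components of `Ω` minus a ball -/

theorem IsComponentOf.subset {X : Type*} [TopologicalSpace X] {T S : Set X}
    (hT : IsComponentOf T S) : T ⊆ S := by
  obtain ⟨x, -, rfl⟩ := hT
  exact connectedComponentIn_subset _ _

/-- A preconnected subset of `S` meeting a component of `S` is contained in it. -/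
theorem IsComponentOf.subset_of_isPreconnected {X : Type*} [TopologicalSpace X] {T S V : Set X}
    (hT : IsComponentOf T S) (hV : IsPreconnected V) (hVS : V ⊆ S) {y : X} (hyV : y ∈ V)
    (hyT : y ∈ T) : V ⊆ T := by
  obtain ⟨x, -, rfl⟩ := hT
  rw [connectedComponentIn_eq hyT]
  exact hV.subset_connectedComponentIn hyV hVS

theorem IsComponentOf.mem_of_mem_closure {X : Type*} [TopologicalSpace X] {T S : Set X}
    (hT : IsComponentOf T S) {y : X} (hyS : y ∈ S) (hy : y ∈ closure T) : y ∈ T := by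
  have hTS := hT.subset
  obtain ⟨x, hx, rfl⟩ := id hT
  have hxT := mem_connectedComponentIn hx
  refine hT.subset_of_isPreconnected (V := insert y (connectedComponentIn S x)) ?_ ?_
    (mem_insert_of_mem _ hxT) hxT (mem_insert _ _)
  · exact isPreconnected_connectedComponentIn.subset_closure (subset_insert _ _)
      (insert_subset hy subset_closure)
  · exact insert_subset hyS hTS

variable {n : ℕ} {Ω T : Set (EuclideanSpace ℝ (Fin n))} {w : EuclideanSpace ℝ (Fin n)} {d : ℝ}

theorem ball_subset_diff {x : EuclideanSpace ℝ (Fin n)} {r : ℝ} (hr : r ≤ rho Ω x)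
    (hd : r ≤ dist x w - d) : ball x r ⊆ Ω \ ball w d := by
  intro y hy
  rw [mem_ball] at hy
  refine ⟨?_, ?_⟩
  · by_contra h
    have : rho Ω x ≤ dist x y := infDist_le_dist_of_mem h
    rw [dist_comm] at this
    linarith
  · rw [mem_ball, not_lt]
    have := dist_triangle_left x w y
    linarith

theorem ball_subset_component (hT : IsComponentOf T (Ω \ ball w d))
    {x y : EuclideanSpace ℝ (Fin n)} {r : ℝ} (hr : r ≤ rho Ω x) (hd : r ≤ dist x w - d)
    (hy : y ∈ ball x r) (hyT : y ∈ T) : ball x r ⊆ T :=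
  hT.subset_of_isPreconnected (convex_ball x r).isPreconnected (ball_subset_diff hr hd) hy hyT

theorem rho_pos (hΩ : IsOpen Ω) (hb : Ωᶜ.Nonempty) {x : EuclideanSpace ℝ (Fin n)} (hx : x ∈ Ω) :
    0 < rho Ω x :=
  (hΩ.isClosed_compl.notMem_iff_infDist_pos hb).1 (by simpa using hx)

theorem rho_nonneg (x : EuclideanSpace ℝ (Fin n)) : 0 ≤ rho Ω x := infDist_nonneg

theorem compl_nonempty_of_isBounded (hn : 2 ≤ n) (hb : Bornology.IsBounded Ω) :
    Ωᶜ.Nonempty := by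
  have : Nonempty (Fin n) := ⟨⟨0, by omega⟩⟩
  rw [nonempty_compl]
  rintro rfl
  exact NormedSpace.unbounded_univ ℝ (EuclideanSpace ℝ (Fin n)) hb

/-- Small balls around such points avoid `ball w d`, so they stay in `T`. `T` itself may fail to be
open along the sphere; measurability is always drawn from these tails. -/
theorem isOpen_component_inter (hΩ : IsOpen Ω) (hb : Ωᶜ.Nonempty)
    (hT : IsComponentOf T (Ω \ ball w d)) {t : ℝ} (ht : d ≤ t) :
    IsOpen (T ∩ {x | t < dist x w}) := by
  rw [Metric.isOpen_iff]
  rintro x ⟨hxT, hx⟩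
  have hx' : t < dist x w := hx
  have hpos : 0 < min (rho Ω x) (dist x w - t) :=
    lt_min (rho_pos hΩ hb (hT.subset hxT).1) (by linarith)
  refine ⟨_, hpos, fun y hy => ⟨?_, ?_⟩⟩
  · exact ball_subset_component hT (min_le_left _ _)
      ((min_le_right _ _).trans (by linarith)) (mem_ball_self hpos) hxT hy
  · have h1 := (mem_ball.1 hy).trans_le (min_le_right _ _)
    have := dist_triangle_left x w y
    change t < dist y w
    linarith

theorem eventually_mem_iff (hΩ : IsOpen Ω) (hb : Ωᶜ.Nonempty)
    (hT : IsComponentOf T (Ω \ ball w d)) {x : EuclideanSpace ℝ (Fin n)} (hx : x ∈ Ω)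
    (hd : d < dist x w) : ∀ᶠ y in nhds x, (y ∈ T ↔ x ∈ T) := by
  have hpos : 0 < min (rho Ω x) (dist x w - d) := lt_min (rho_pos hΩ hb hx) (by linarith)
  filter_upwards [ball_mem_nhds x hpos] with y hy
  constructor
  · intro h
    exact ball_subset_component hT (min_le_left _ _) (min_le_right _ _) hy h (mem_ball_self hpos)
  · intro h
    exact ball_subset_component hT (min_le_left _ _) (min_le_right _ _) (mem_ball_self hpos) h hy

/-- A ball that cuts off a component away from a bigger ball is not compactly inside `Ω`. -/
theorem rho_center_le (hn : 2 ≤ n) (hΩ : IsBoundedDomain Ω) (hw : w ∈ Ω) (hd : 0 < d)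
    (hT : IsComponentOf T (Ω \ ball w d)) {x₀ : EuclideanSpace ℝ (Fin n)} {r₀ : ℝ}
    (hB : ball x₀ r₀ ⊆ Ω) (hdisj : Disjoint T (ball x₀ r₀)) (hdr : d < r₀) : rho Ω w ≤ d := by
  have hb := compl_nonempty_of_isBounded hn hΩ.isBounded
  by_contra! hlt
  have hcl : closedBall w d ⊆ Ω := by
    intro y hy
    by_contra h
    have : rho Ω w ≤ dist w y := infDist_le_dist_of_mem h
    rw [dist_comm] at this
    have := mem_closedBall.1 hy
    linarith
  have : Nonempty (Fin n) := ⟨⟨0, by omega⟩⟩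
  have hsph : IsPreconnected (sphere w d) := by
    apply isPreconnected_sphere
    rw [← Module.finrank_eq_rank]
    simp
    exact_mod_cast hn
  have hsub : sphere w d ⊆ Ω \ ball w d := fun y hy =>
    ⟨hcl (sphere_subset_closedBall hy), by
      rw [mem_sphere] at hy
      rw [mem_ball, hy]
      exact lt_irrefl _⟩
  -- A component avoiding the sphere would be open and relatively closed in the connected set `Ω`,
  -- yet it misses `w`.
  have hmeet : ∀ U : Set (EuclideanSpace ℝ (Fin n)), IsComponentOf U (Ω \ ball w d) →
      ∃ y ∈ sphere w d, y ∈ U := by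
    intro U hU
    by_contra! hno
    have hfar : ∀ y ∈ U, d < dist y w := by
      intro y hy
      have h1 : d ≤ dist y w := not_lt.1 (hU.subset hy).2
      exact lt_of_le_of_ne h1 fun h => hno y (mem_sphere.2 h.symm) hy
    have hpre := hΩ.isConnected.isPreconnected
    have hUo : IsOpen U := by
      have := isOpen_component_inter hΩ.isOpen hb hU le_rfl
      rwa [inter_eq_left.2 (show U ⊆ {x | d < dist x w} from hfar)] at this
    have hVo : IsOpen (Ω \ U) := by
      have : Ω \ U = Ω ∩ (closure U)ᶜ := by
        ext y
        refine ⟨fun hy => ⟨hy.1, fun hc => hy.2 ?_⟩, fun hy => ⟨hy.1, fun h => hy.2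
          (subset_closure h)⟩⟩
        refine hU.mem_of_mem_closure ⟨hy.1, fun hyw => ?_⟩ hc
        obtain ⟨z, hzw, hz⟩ := mem_closure_iff.1 hc _ isOpen_ball hyw
        exact (hU.subset hz).2 hzw
      rw [this]
      exact hΩ.isOpen.inter isClosed_closure.isOpen_compl
    obtain ⟨y, hyS, hyU⟩ := hU
    have hyU' : y ∈ U := by rw [hyU]; exact mem_connectedComponentIn hyS
    obtain ⟨z, -, hz1, hz2⟩ := hpre U (Ω \ U) hUo hVo (fun z hz => by
      by_cases h : z ∈ U
      · exact Or.inl h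
      · exact Or.inr ⟨hz, h⟩) ⟨y, hyS.1, hyU'⟩ ⟨w, hw, hw, fun h => by
        have := hfar w h; rw [dist_self] at this; linarith⟩
    exact hz2.2 hz1
  -- The component of `y` and `T` both meet the sphere, which is connected as `n ≥ 2`; hence they
  -- coincide, and `T` meets the fixed ball.
  obtain ⟨y, hyB, hyw⟩ : ∃ y ∈ ball x₀ r₀, y ∉ ball w d := by
    by_contra! h
    have h1 := diam_mono (show ball x₀ r₀ ⊆ ball w d from h) isBounded_ball
    rw [diam_ball_eq, diam_ball_eq] at h1 <;> linarith
  have hyS : y ∈ Ω \ ball w d := ⟨hB hyB, hyw⟩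
  obtain ⟨z, hzs, hz⟩ := hmeet _ ⟨y, hyS, rfl⟩
  obtain ⟨z', hzs', hz'⟩ := hmeet T hT
  have h1 := hT.subset_of_isPreconnected hsph hsub hzs' hz' hzs
  have h2 := hT.subset_of_isPreconnected isPreconnected_connectedComponentIn
    (connectedComponentIn_subset _ _) hz h1 (mem_connectedComponentIn hyS)
  exact (disjoint_left.1 hdisj h2) hyB

/-! ### The test function -/

/-- A radial cutoff around `w`, vanishing for `dist x w ≤ t + s / 3` and equal to `1` for
`t + 2 * s / 3 ≤ dist x w`. -/
noncomputable def radialCutoff (w : EuclideanSpace ℝ (Fin n)) (t s : ℝ)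
    (x : EuclideanSpace ℝ (Fin n)) : ℝ :=
  Real.smoothTransition (3 / s * (dist x w - t) - 1)

theorem radialCutoff_eq_zero {t s : ℝ} (hs : 0 < s) {x : EuclideanSpace ℝ (Fin n)}
    (hx : dist x w ≤ t + s / 3) : radialCutoff w t s x = 0 := by
  apply Real.smoothTransition.zero_of_nonpos
  have h : 3 / s * (dist x w - t) ≤ 3 / s * (s / 3) :=
    mul_le_mul_of_nonneg_left (by linarith) (by positivity)
  rw [show 3 / s * (s / 3) = 1 by field_simp] at h
  linarith

theorem radialCutoff_eq_one {t s : ℝ} (hs : 0 < s) {x : EuclideanSpace ℝ (Fin n)}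
    (hx : t + 2 * s / 3 ≤ dist x w) : radialCutoff w t s x = 1 := by
  apply Real.smoothTransition.one_of_one_le
  have h : 3 / s * (2 * s / 3) ≤ 3 / s * (dist x w - t) :=
    mul_le_mul_of_nonneg_left (by linarith) (by positivity)
  rw [show 3 / s * (2 * s / 3) = 2 by field_simp] at h
  linarith

theorem lipschitzWith_radialCutoff {L : NNReal} (hL : LipschitzWith L Real.smoothTransition)
    (w : EuclideanSpace ℝ (Fin n)) (t : ℝ) {s : ℝ} (hs : 0 < s) :
    LipschitzWith (L * (3 / s).toNNReal) (radialCutoff w t s) := by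
  refine hL.comp (LipschitzWith.of_dist_le_mul fun x y => ?_)
  rw [Real.coe_toNNReal _ (by positivity), Real.dist_eq,
    show 3 / s * (dist x w - t) - 1 - (3 / s * (dist y w - t) - 1)
      = 3 / s * (dist x w - dist y w) by ring, abs_mul, abs_of_pos (by positivity)]
  exact mul_le_mul_of_nonneg_left (abs_dist_sub_le x y w) (by positivity)

theorem contDiffAt_radialCutoff (t s : ℝ) {x : EuclideanSpace ℝ (Fin n)} (hx : x ≠ w) :
    ContDiffAt ℝ ∞ (radialCutoff w t s) x := by
  unfold radialCutoff
  refine Real.smoothTransition.contDiff.contDiffAt.comp x ?_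
  have : ContDiffAt ℝ ∞ (fun y => dist y w) x :=
    contDiffAt_id.dist ℝ contDiffAt_const hx
  fun_prop

open Classical in
theorem indicator_radialCutoff_eventuallyEq (hΩ : IsOpen Ω) (hb : Ωᶜ.Nonempty)
    (hT : IsComponentOf T (Ω \ ball w d)) {t s : ℝ} {x : EuclideanSpace ℝ (Fin n)}
    (hx : x ∈ Ω) (hd : d < dist x w) :
    T.indicator (radialCutoff w t s) =ᶠ[nhds x] (if x ∈ T then radialCutoff w t s else 0) := by
  filter_upwards [eventually_mem_iff hΩ hb hT hx hd] with y hy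
  by_cases h : x ∈ T
  · simp [h, hy.2 h]
  · simp [h, hy]

theorem indicator_radialCutoff_eventuallyEq_zero {t s : ℝ} (hs : 0 < s)
    {x : EuclideanSpace ℝ (Fin n)} (hx : dist x w ≤ t) :
    T.indicator (radialCutoff w t s) =ᶠ[nhds x] 0 := by
  have : {y | dist y w < t + s / 3} ∈ nhds x :=
    (isOpen_lt (by fun_prop) continuous_const).mem_nhds (by
      change dist x w < t + s / 3; linarith)
  filter_upwards [this] with y hy
  simp [radialCutoff_eq_zero hs (le_of_lt hy)]

theorem contDiffOn_indicator_radialCutoff (hΩ : IsOpen Ω) (hb : Ωᶜ.Nonempty)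
    (hT : IsComponentOf T (Ω \ ball w d)) (hd : 0 < d) {t s : ℝ} (hdt : d ≤ t) (hs : 0 < s) :
    ContDiffOn ℝ ∞ (T.indicator (radialCutoff w t s)) Ω := by
  intro x hx
  refine ContDiffAt.contDiffWithinAt ?_
  rcases le_or_gt (dist x w) t with h | h
  · exact contDiffAt_const.congr_of_eventuallyEq (indicator_radialCutoff_eventuallyEq_zero hs h)
  · refine ContDiffAt.congr_of_eventuallyEq ?_
      (indicator_radialCutoff_eventuallyEq hΩ hb hT hx (hdt.trans_lt h))
    split_ifs
    · refine contDiffAt_radialCutoff t s ?_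
      rw [← dist_pos]; linarith
    · exact contDiffAt_const

theorem norm_gradient_indicator_radialCutoff_le (hΩ : IsOpen Ω) (hb : Ωᶜ.Nonempty)
    (hT : IsComponentOf T (Ω \ ball w d)) {t s : ℝ} (hdt : d ≤ t) (hs : 0 < s)
    {L : NNReal} (hL : LipschitzWith L Real.smoothTransition)
    {x : EuclideanSpace ℝ (Fin n)} (hx : x ∈ Ω) :
    ‖∇ (T.indicator (radialCutoff w t s)) x‖ ≤
      (T ∩ {x | t < dist x w ∧ dist x w < t + s}).indicator (fun _ => L * (3 / s)) x := by
  have hgrad : ‖∇ (T.indicator (radialCutoff w t s)) x‖ =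
      ‖fderiv ℝ (T.indicator (radialCutoff w t s)) x‖ := by
    unfold gradient; exact LinearIsometryEquiv.norm_map _ _
  rw [hgrad]
  by_cases hA : x ∈ T ∩ {x | t < dist x w ∧ dist x w < t + s}
  · rw [indicator_of_mem hA, (indicator_radialCutoff_eventuallyEq hΩ hb hT hx
      (hdt.trans_lt hA.2.1)).fderiv_eq, if_pos hA.1]
    have := norm_fderiv_le_of_lipschitz ℝ (lipschitzWith_radialCutoff hL w t hs) (x₀ := x)
    rwa [NNReal.coe_mul, Real.coe_toNNReal _ (by positivity)] at this
  · rw [indicator_of_notMem hA]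
    suffices h : ∃ c : ℝ, T.indicator (radialCutoff w t s) =ᶠ[nhds x] fun _ => c by
      obtain ⟨c, hc⟩ := h
      rw [hc.fderiv_eq]; simp
    rcases le_or_gt (dist x w) t with h | h
    · exact ⟨0, indicator_radialCutoff_eventuallyEq_zero hs h⟩
    · have he := indicator_radialCutoff_eventuallyEq (s := s) (t := t) hΩ hb hT hx
        (hdt.trans_lt h)
      by_cases hxT : x ∈ T
      · refine ⟨1, he.trans ?_⟩
        rw [if_pos hxT]
        have hfar : t + s ≤ dist x w := not_lt.1 fun h' => hA ⟨hxT, h, h'⟩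
        have : {y | t + 2 * s / 3 < dist y w} ∈ nhds x :=
          (isOpen_lt continuous_const (by fun_prop)).mem_nhds (by
            change t + 2 * s / 3 < dist x w; linarith)
        filter_upwards [this] with y hy
        exact radialCutoff_eq_one hs (le_of_lt hy)
      · refine ⟨0, he.trans ?_⟩
        rw [if_neg hxT]
        rfl

theorem integrableOn_indicator_radialCutoff (hΩ : IsBoundedDomain Ω) (hb : Ωᶜ.Nonempty)
    (hT : IsComponentOf T (Ω \ ball w d)) {t s : ℝ} (hdt : d ≤ t) (hs : 0 < s) :
    IntegrableOn (T.indicator (radialCutoff w t s)) Ω volume := by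
  have hu : T.indicator (radialCutoff w t s) =
      (T ∩ {x | t < dist x w}).indicator (radialCutoff w t s) := by
    ext x
    by_cases hxT : x ∈ T
    · by_cases h : t < dist x w
      · rw [indicator_of_mem hxT, indicator_of_mem (show x ∈ T ∩ {x | t < dist x w} from ⟨hxT, h⟩)]
      · rw [indicator_of_mem hxT, indicator_of_notMem fun h' : x ∈ T ∩ {x | t < dist x w} => h h'.2,
          radialCutoff_eq_zero hs (by linarith)]
    · rw [indicator_of_notMem hxT, indicator_of_notMem fun h' => hxT h'.1]
  have hc : Continuous (radialCutoff w t s) := by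
    unfold radialCutoff
    exact Real.smoothTransition.continuous.comp (by fun_prop)
  rw [hu]
  refine IntegrableOn.indicator ?_ (isOpen_component_inter hΩ.isOpen hb hT hdt).measurableSet
  refine Measure.integrableOn_of_bounded (M := 1) hΩ.isBounded.measure_lt_top.ne
    hc.aestronglyMeasurable (Filter.Eventually.of_forall fun x => ?_)
  unfold radialCutoff
  rw [Real.norm_of_nonneg (Real.smoothTransition.nonneg _)]
  exact Real.smoothTransition.le_one _

/-! ### The capacity estimate -/

theorem ofReal_mul_le_setLIntegral {V : Set (EuclideanSpace ℝ (Fin n))} (hV : MeasurableSet V)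
    (hVΩ : V ⊆ Ω) (hfin : volume V ≠ ⊤) {f : EuclideanSpace ℝ (Fin n) → ℝ} {q : ℝ} (hq : 0 ≤ q)
    (hf : ∀ x ∈ V, 1 / 2 ≤ ‖f x‖) :
    ENNReal.ofReal ((1 / 2) ^ q * volume.real V) ≤ ∫⁻ x in Ω, ‖f x‖ₑ ^ q := by
  refine le_trans ?_ (lintegral_mono_set hVΩ)
  rw [ENNReal.ofReal_mul (by positivity), ofReal_measureReal hfin, ← setLIntegral_const]
  refine setLIntegral_mono' hV fun x hx => ?_
  rw [← ofReal_norm, ENNReal.ofReal_rpow_of_nonneg (norm_nonneg _) hq]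
  exact ENNReal.ofReal_le_ofReal (Real.rpow_le_rpow (by norm_num) (hf x hx) hq)

theorem IsSobolevTriple.b_nonneg {p q b : ℝ} (h : IsSobolevTriple n p q b) : 0 ≤ b := by
  rw [h.eq]
  exact mul_nonneg (by linarith [h.one_le]) h.nonneg

theorem exists_capacity_estimate (hn : 2 ≤ n) (hΩ : IsBoundedDomain Ω) {p q b C₀ : ℝ}
    (hpqb : IsSobolevTriple n p q b) (hC₀ : 0 < C₀) (hP : PoincareInequality Ω p q b C₀)
    {x₀ : EuclideanSpace ℝ (Fin n)} {r₀ : ℝ} (hr₀ : 0 < r₀) (hB₀ : ball x₀ r₀ ⊆ Ω) :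
    ∃ C : ℝ, 0 < C ∧ ∀ (w : EuclideanSpace ℝ (Fin n)) (d : ℝ)
      (T : Set (EuclideanSpace ℝ (Fin n))), 0 < d → IsComponentOf T (Ω \ ball w d) →
      Disjoint T (ball x₀ r₀) → ∀ t s M : ℝ, d ≤ t → 0 < s → 0 ≤ M →
      (∀ x ∈ T, t < dist x w → dist x w < t + s → rho Ω x ≤ M) →
      volume.real (T ∩ {x | t + s < dist x w}) ^ (p / q) ≤
        C * s ^ (-p) * M ^ b *
          volume.real (T ∩ {x | t < dist x w ∧ dist x w < t + s}) := by
  have hb := compl_nonempty_of_isBounded hn hΩ.isBounded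
  obtain ⟨L, hL⟩ := exists_lipschitzWith_smoothTransition
  have hp : 0 < p := by linarith [hpqb.one_le]
  have hq : 0 < q := by linarith [hpqb.le]
  have hΩfin : volume Ω ≠ ⊤ := hΩ.isBounded.measure_lt_top.ne
  have hBpos : 0 < volume.real (ball x₀ r₀) :=
    ENNReal.toReal_pos (measure_ball_pos volume x₀ hr₀).ne' measure_ball_lt_top.ne
  have hBle : volume.real (ball x₀ r₀) ≤ volume.real Ω := measureReal_mono hB₀ hΩfin
  have hΩpos : 0 < volume.real Ω := hBpos.trans_le hBle
  -- If the mean of `u` is at most `1 / 2`, then `u` is `1 / 2` away from it on the tail, otherwise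
  -- on the fixed ball. The volume ratio turns either bound into a multiple of the tail volume.
  set κ : ℝ := (1 / 2) ^ q * (volume.real (ball x₀ r₀) / volume.real Ω) with hκ
  have hκpos : 0 < κ := by positivity
  -- `L + 1` replaces `L` to keep the constant positive.
  refine ⟨(κ ^ (p / q))⁻¹ * (C₀ * (3 * (L + 1)) ^ p), by positivity, ?_⟩
  intro w d T hd hT hdisj t s M hdt hs hM hρ
  have hTΩ : T ⊆ Ω := fun x hx => (hT.subset hx).1
  set A := T ∩ {x | t < dist x w ∧ dist x w < t + s} with hA
  set V := T ∩ {x | t + s < dist x w} with hV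
  have hAmeas : MeasurableSet A := by
    have : A = T ∩ {x | t < dist x w} ∩ {x | dist x w < t + s} := by
      ext x; exact and_assoc.symm
    rw [this]
    exact (isOpen_component_inter hΩ.isOpen hb hT hdt).measurableSet.inter
      (isOpen_lt (by fun_prop) continuous_const).measurableSet
  have hVmeas : MeasurableSet V :=
    (isOpen_component_inter hΩ.isOpen hb hT (by linarith)).measurableSet
  have hVΩ : V ⊆ Ω := inter_subset_left.trans hTΩ
  have hAΩ : A ⊆ Ω := inter_subset_left.trans hTΩ
  have hVfin : volume V ≠ ⊤ := measure_ne_top_of_subset hVΩ hΩfin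
  have hAfin : volume A ≠ ⊤ := measure_ne_top_of_subset hAΩ hΩfin
  have hVle : volume.real V ≤ volume.real Ω := measureReal_mono hVΩ hΩfin
  set u := T.indicator (radialCutoff w t s) with hu
  have hPu := hP u (contDiffOn_indicator_radialCutoff hΩ.isOpen hb hT hd hdt hs)
    (integrableOn_indicator_radialCutoff hΩ hb hT hdt hs)
  set c := ⨍ y in Ω, u y with hc
  have hleft : ENNReal.ofReal (κ * volume.real V) ≤ ∫⁻ x in Ω, ‖u x - c‖ₑ ^ q := by
    by_cases hc2 : c ≤ 1 / 2
    · refine le_trans (ENNReal.ofReal_le_ofReal ?_)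
        (ofReal_mul_le_setLIntegral hVmeas hVΩ hVfin hq.le fun x hx => ?_)
      · refine mul_le_mul_of_nonneg_right ?_ measureReal_nonneg
        exact mul_le_of_le_one_right (by positivity) ((div_le_one hΩpos).2 hBle)
      · have hx2 : t + s < dist x w := hx.2
        rw [hu, indicator_of_mem hx.1, radialCutoff_eq_one hs (by linarith), Real.norm_eq_abs]
        exact le_trans (by linarith) (le_abs_self _)
    · refine le_trans (ENNReal.ofReal_le_ofReal ?_)
        (ofReal_mul_le_setLIntegral (V := ball x₀ r₀) measurableSet_ball hB₀
          measure_ball_lt_top.ne hq.le fun x hx => ?_)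
      · rw [hκ, mul_assoc]
        refine mul_le_mul_of_nonneg_left ?_ (by positivity)
        rw [div_mul_eq_mul_div, div_le_iff₀ hΩpos]
        exact mul_le_mul_of_nonneg_left hVle hBpos.le
      · rw [hu, indicator_of_notMem (disjoint_right.1 hdisj hx), Real.norm_eq_abs]
        exact le_trans (by linarith) (neg_le_abs _)
  have hright : ∫⁻ x in Ω, ‖∇ u x‖ₑ ^ p * ENNReal.ofReal (rho Ω x ^ b) ≤
      ENNReal.ofReal ((L * (3 / s)) ^ p * M ^ b * volume.real A) := by
    rw [ENNReal.ofReal_mul (by positivity), ofReal_measureReal hAfin,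
      ← lintegral_indicator_const hAmeas]
    refine le_trans (setLIntegral_mono' hΩ.isOpen.measurableSet fun x hx => ?_)
      (setLIntegral_le_lintegral Ω _)
    have hg := norm_gradient_indicator_radialCutoff_le hΩ.isOpen hb hT hdt hs hL hx
    rw [← hu, ← hA] at hg
    by_cases hxA : x ∈ A
    · rw [indicator_of_mem hxA] at hg ⊢
      rw [ENNReal.ofReal_mul (by positivity), ← ofReal_norm,
        ENNReal.ofReal_rpow_of_nonneg (norm_nonneg _) hp.le]
      refine mul_le_mul' (ENNReal.ofReal_le_ofReal (Real.rpow_le_rpow (norm_nonneg _) hg hp.le))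
        (ENNReal.ofReal_le_ofReal (Real.rpow_le_rpow (rho_nonneg x)
          (hρ x hxA.1 hxA.2.1 hxA.2.2) hpqb.b_nonneg))
    · rw [indicator_of_notMem hxA] at hg
      have h0 : ∇ u x = 0 := norm_le_zero_iff.1 hg
      rw [h0, enorm_zero, ENNReal.zero_rpow_of_pos hp, zero_mul]
      exact zero_le
  have hpq : 0 ≤ p / q := by positivity
  have hmain := (ENNReal.rpow_le_rpow hleft hpq).trans
    (hPu.trans (mul_le_mul' le_rfl hright))
  rw [ENNReal.ofReal_rpow_of_nonneg (by positivity) hpq, ← ENNReal.ofReal_mul hC₀.le,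
    ENNReal.ofReal_le_ofReal_iff (by positivity),
    Real.mul_rpow hκpos.le measureReal_nonneg] at hmain
  have hLs : (L * (3 / s)) ^ p ≤ (3 * ((L : ℝ) + 1)) ^ p * s ^ (-p) := by
    rw [Real.rpow_neg hs.le, ← Real.inv_rpow hs.le, ← Real.mul_rpow (by positivity)
      (by positivity)]
    refine Real.rpow_le_rpow (by positivity) ?_ hp.le
    rw [show (L : ℝ) * (3 / s) = 3 * L * s⁻¹ by ring]
    gcongr
    linarith
  rw [mul_assoc (κ ^ (p / q))⁻¹, mul_assoc (κ ^ (p / q))⁻¹, mul_assoc (κ ^ (p / q))⁻¹,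
    inv_mul_eq_div, le_div_iff₀' (by positivity)]
  refine hmain.trans ?_
  calc C₀ * ((L * (3 / s)) ^ p * M ^ b * volume.real A)
      ≤ C₀ * ((3 * ((L : ℝ) + 1)) ^ p * s ^ (-p) * M ^ b * volume.real A) := by gcongr
    _ = _ := by ring

/-! ### The tail radius -/

theorem measureReal_ball_eq (x : EuclideanSpace ℝ (Fin n)) {r : ℝ} (hr : 0 < r) :
    volume.real (ball x r) =
      r ^ n * volume.real (ball (0 : EuclideanSpace ℝ (Fin n)) 1) := by
  rw [measureReal_def, Measure.addHaar_ball_of_pos _ _ hr, ENNReal.toReal_mul,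
    ENNReal.toReal_ofReal (by positivity), finrank_euclideanSpace_fin, measureReal_def]

/-- The radius of a ball with the volume of the part of `T` farther than `t` from `w`. -/
noncomputable def tailRadius (T : Set (EuclideanSpace ℝ (Fin n))) (w : EuclideanSpace ℝ (Fin n))
    (t : ℝ) : ℝ :=
  (volume.real (T ∩ {x | t < dist x w}) /
    volume.real (ball (0 : EuclideanSpace ℝ (Fin n)) 1)) ^ (n⁻¹ : ℝ)

theorem measureReal_unitBall_pos : 0 < volume.real (ball (0 : EuclideanSpace ℝ (Fin n)) 1) :=
  ENNReal.toReal_pos (measure_ball_pos volume _ one_pos).ne' measure_ball_lt_top.ne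

theorem tailRadius_nonneg (t : ℝ) : 0 ≤ tailRadius T w t := by
  unfold tailRadius; positivity

theorem measureReal_tail (hn : 2 ≤ n) (t : ℝ) :
    volume.real (T ∩ {x | t < dist x w}) =
      volume.real (ball (0 : EuclideanSpace ℝ (Fin n)) 1) * tailRadius T w t ^ n := by
  unfold tailRadius
  rw [Real.rpow_inv_natCast_pow (by positivity) (by omega),
    mul_div_cancel₀ _ measureReal_unitBall_pos.ne']

theorem tailRadius_antitone (hT : volume T ≠ ⊤) : Antitone (tailRadius T w) := by
  intro s t hst
  unfold tailRadius
  refine Real.rpow_le_rpow (by positivity) ?_ (by positivity)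
  refine div_le_div_of_nonneg_right ?_ measureReal_nonneg
  exact measureReal_mono (fun x hx => ⟨hx.1, lt_of_le_of_lt hst hx.2⟩)
    (measure_ne_top_of_subset inter_subset_left hT)

/-- Points of `T` far from `w` are close to the complement of `Ω`, since `T` contains balls
around them. -/
theorem rho_le_tailRadius (hn : 2 ≤ n) (hΩ : IsBoundedDomain Ω)
    (hT : IsComponentOf T (Ω \ ball w d)) {t : ℝ} (hdt : d ≤ t)
    {x : EuclideanSpace ℝ (Fin n)} (hx : x ∈ T) (hxt : t + tailRadius T w t < dist x w) :
    rho Ω x ≤ tailRadius T w t := by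
  by_contra! hlt
  have hg0 : 0 ≤ tailRadius T w t := tailRadius_nonneg t
  set r := min (rho Ω x) (dist x w - t) with hr
  have hgr : tailRadius T w t < r := lt_min hlt (by linarith)
  have hsub : ball x r ⊆ T ∩ {x | t < dist x w} := by
    intro y hy
    refine ⟨ball_subset_component hT (min_le_left _ _)
      ((min_le_right _ _).trans (by linarith)) (mem_ball_self (by linarith)) hx hy, ?_⟩
    have h1 := (mem_ball.1 hy).trans_le (min_le_right _ _)
    have := dist_triangle_left x w y
    change t < dist y w
    linarith
  have hfin : volume (T ∩ {x | t < dist x w}) ≠ ⊤ :=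
    measure_ne_top_of_subset (fun y hy => (hT.subset hy.1).1)
      hΩ.isBounded.measure_lt_top.ne
  have h1 := measureReal_mono hsub hfin
  rw [measureReal_ball_eq x (by linarith), measureReal_tail hn, mul_comm] at h1
  have h2 := le_of_mul_le_mul_left h1 measureReal_unitBall_pos
  have h3 := pow_lt_pow_left₀ hgr hg0 (show n ≠ 0 by omega)
  linarith

theorem subset_closedBall_of_tailRadius_eq_zero (hn : 2 ≤ n) (hΩ : IsBoundedDomain Ω)
    (hT : IsComponentOf T (Ω \ ball w d)) {t : ℝ} (hdt : d ≤ t) (h : tailRadius T w t = 0) :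
    T ⊆ closedBall w t := by
  have hb := compl_nonempty_of_isBounded hn hΩ.isBounded
  have hopen := isOpen_component_inter hΩ.isOpen hb hT hdt
  have hfin : volume (T ∩ {x | t < dist x w}) ≠ ⊤ :=
    measure_ne_top_of_subset (fun y hy => (hT.subset hy.1).1)
      hΩ.isBounded.measure_lt_top.ne
  have h0 : volume (T ∩ {x | t < dist x w}) = 0 := by
    rw [← measureReal_eq_zero_iff hfin, measureReal_tail hn, h,
      zero_pow (by omega), mul_zero]
  rw [hopen.measure_eq_zero_iff (μ := volume)] at h0
  intro x hx
  rw [mem_closedBall]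
  by_contra! hlt
  exact (eq_empty_iff_forall_notMem.1 h0 x) ⟨hx, hlt⟩

theorem le_mul_of_rpow_le {y K g α : ℝ} (hy : 0 ≤ y) (hK : 0 ≤ K) (hg : 0 ≤ g) (hα : 0 < α)
    (h : y ^ α ≤ K * g ^ α) : y ≤ K ^ α⁻¹ * g := by
  rw [← Real.rpow_le_rpow_iff hy (by positivity) hα, Real.mul_rpow (by positivity) hg,
    Real.rpow_inv_rpow hK hα.ne']
  exact h

end WeightedPoincare

/-! ### Iteration and conclusion -/

open WeightedPoincare in
theorem proposition2p1 (n : ℕ) (hn : 2 ≤ n)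
    (Ω : Set (EuclideanSpace ℝ (Fin n))) (hΩ : WeightedPoincare.IsBoundedDomain Ω)
    (p q b : ℝ) (hpqb : WeightedPoincare.IsSobolevTriple n p q b)
    (C₀ : ℝ) (hC₀ : 0 < C₀) (hP : WeightedPoincare.PoincareInequality Ω p q b C₀)
    (x₀ : EuclideanSpace ℝ (Fin n)) (r₀ : ℝ) (hr₀ : 0 < r₀) (hB₀ : Metric.ball x₀ r₀ ⊆ Ω) :
    ∃ C : ℝ, 0 < C ∧
      ∀ w ∈ Ω, ∀ d : ℝ, 0 < d → ∀ T : Set (EuclideanSpace ℝ (Fin n)),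
        WeightedPoincare.IsComponentOf T (Ω \ Metric.ball w d) →
        Disjoint T (Metric.ball x₀ r₀) →
        Metric.diam T ≤ C * d := by
  obtain ⟨C₁, hC₁, hcap⟩ := exists_capacity_estimate hn hΩ hpqb hC₀ hP hr₀ hB₀
  have hp : 0 < p := by linarith [hpqb.one_le]
  have hq : 0 < q := by linarith [hpqb.le]
  have hn0 : (0 : ℝ) < n := by exact_mod_cast (by omega : 0 < n)
  set v := volume.real (ball (0 : EuclideanSpace ℝ (Fin n)) 1) with hv
  have hvpos : 0 < v := measureReal_unitBall_pos
  set α : ℝ := n * (p / q) with hα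
  have hαpos : 0 < α := by positivity
  have hexp : -p + b + n = α := by rw [hpqb.eq, hα]; field_simp; ring
  have hscale : ∀ {g : ℝ}, 0 < g → g ^ (-p) * g ^ b * g ^ n = g ^ α := fun {g} hg => by
    rw [← Real.rpow_natCast g n, ← Real.rpow_add hg, ← Real.rpow_add hg, hexp]
  have htail : ∀ {T : Set (EuclideanSpace ℝ (Fin n))} {w} (t : ℝ),
      volume.real (T ∩ {x | t < dist x w}) ^ (p / q) = v ^ (p / q) * tailRadius T w t ^ α := by
    intro T w t
    have hg := tailRadius_nonneg (T := T) (w := w) t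
    rw [measureReal_tail hn, Real.mul_rpow hvpos.le (by positivity),
      ← Real.rpow_natCast, ← Real.rpow_mul hg]
  set D := C₁ * v / v ^ (p / q) with hD
  have hDpos : 0 < D := by positivity
  -- `A` makes the tail radius halve after a step of length `(1 + A) * tailRadius`
  set A := max 1 (D * 2 ^ α) with hA
  have hA1 : 1 ≤ A := le_max_left _ _
  -- `p ≥ 1` gives `A ^ (-p) ≤ A⁻¹`, so a linear choice of `A` in `D` is enough.
  have hAD : D * A ^ (-p) ≤ (1 / 2) ^ α := by
    have h1 : A ^ (-p) ≤ A⁻¹ := by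
      rw [← Real.rpow_neg_one]
      exact Real.rpow_le_rpow_of_exponent_le hA1 (by linarith [hpqb.one_le])
    calc D * A ^ (-p) ≤ D * (D * 2 ^ α)⁻¹ := by
          gcongr
          exact h1.trans (inv_anti₀ (by positivity) (le_max_right _ _))
      _ = (1 / 2) ^ α := by
          rw [one_div, Real.inv_rpow (by norm_num)]; field_simp
  -- `3 ^ b` comes from `ρ ≤ 3 d` on the first annulus, `2 ^ n` from the volume of `ball w (2 * d)`.
  set G := (D * 3 ^ b * 2 ^ n) ^ α⁻¹ with hG
  have hGpos : 0 < G := by positivity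
  refine ⟨max (2 * (2 + 2 * (1 + A) * G)) (diam Ω / r₀), lt_max_of_lt_left (by positivity), ?_⟩
  intro w hw d hd T hT hdisj
  have hTΩ : T ⊆ Ω := fun x hx => (hT.subset hx).1
  rcases le_or_gt r₀ d with hdr | hdr
  · calc diam T ≤ diam Ω := diam_mono hTΩ hΩ.isBounded
      _ = diam Ω / r₀ * r₀ := by field_simp
      _ ≤ diam Ω / r₀ * d := mul_le_mul_of_nonneg_left hdr (by positivity)
      _ ≤ _ := mul_le_mul_of_nonneg_right (le_max_right _ _) hd.le
  have hρw := rho_center_le hn hΩ hw hd hT hB₀ hdisj hdr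
  have hTfin : volume T ≠ ⊤ := measure_ne_top_of_subset hTΩ hΩ.isBounded.measure_lt_top.ne
  have hstart : tailRadius T w (2 * d) ≤ G * d := by
    have h := hcap w d T hd hT hdisj d d (3 * d) le_rfl hd (by positivity) (fun x _ _ hx => by
      have : rho Ω x ≤ rho Ω w + dist x w := infDist_le_infDist_add_dist
      linarith)
    rw [← two_mul, htail] at h
    have hann : volume.real (T ∩ {x | d < dist x w ∧ dist x w < 2 * d}) ≤ (2 * d) ^ n * v := by
      rw [← measureReal_ball_eq w (by positivity)]
      exact measureReal_mono (fun x hx => mem_ball.2 hx.2.2) measure_ball_lt_top.ne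
    refine le_mul_of_rpow_le (tailRadius_nonneg _) (by positivity) hd.le hαpos ?_
    rw [← mul_le_mul_iff_right₀ (show 0 < v ^ (p / q) by positivity)]
    refine h.trans ((mul_le_mul_of_nonneg_left hann (by positivity)).trans_eq ?_)
    rw [← hscale hd, Real.mul_rpow (by norm_num) hd.le, mul_pow, hD]
    field_simp
  have hhalf : ∀ t, 2 * d ≤ t →
      tailRadius T w (t + (1 + A) * tailRadius T w t) ≤ tailRadius T w t / 2 := by
    intro t ht
    have hanti := tailRadius_antitone (w := w) hTfin
    set g := tailRadius T w t with hg
    rcases (tailRadius_nonneg (T := T) (w := w) t).eq_or_lt with h0 | hgpos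
    · rw [← hg] at h0
      have : tailRadius T w (t + (1 + A) * g) = g := by rw [← h0, mul_zero, add_zero, ← hg, ← h0]
      rw [this, ← h0]; simp
    rw [← hg] at hgpos
    -- The annulus starts at `t + g`, beyond which `ρ ≤ g`; its volume is at most that of the tail
    -- beyond `t`.
    have h := hcap w d T hd hT hdisj (t + g) (A * g) g (by linarith) (by positivity) hgpos.le
      (fun x hx h1 _ => rho_le_tailRadius hn hΩ hT (by linarith) hx h1)
    rw [show t + g + A * g = t + (1 + A) * g by ring, htail] at h
    have hann : volume.real (T ∩ {x | t + g < dist x w ∧ dist x w < t + (1 + A) * g}) ≤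
        v * g ^ n := by
      rw [hg, ← measureReal_tail hn]
      refine measureReal_mono (fun x hx => ⟨hx.1, ?_⟩)
        (measure_ne_top_of_subset inter_subset_left hTfin)
      have := hx.2.1
      change t < dist x w
      linarith
    have hgoal : tailRadius T w (t + (1 + A) * g) ^ α ≤ (1 / 2 * g) ^ α := by
      rw [Real.mul_rpow (by norm_num) hgpos.le]
      refine le_trans ?_ (mul_le_mul_of_nonneg_right hAD (by positivity))
      rw [← mul_le_mul_iff_right₀ (show 0 < v ^ (p / q) by positivity)]
      refine h.trans ((mul_le_mul_of_nonneg_left hann (by positivity)).trans_eq ?_)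
      rw [← hscale hgpos, Real.mul_rpow (by positivity) hgpos.le, hD]
      field_simp
    rw [Real.rpow_le_rpow_iff (tailRadius_nonneg _) (by positivity) hαpos] at hgoal
    linarith
  have hzero := eq_zero_of_halving (tailRadius_antitone hTfin) tailRadius_nonneg
    (by positivity) hhalf
  have hR : 2 * d + 2 * (1 + A) * tailRadius T w (2 * d) ≤ (2 + 2 * (1 + A) * G) * d := by
    have := mul_le_mul_of_nonneg_left hstart (show 0 ≤ 2 * (1 + A) by positivity)
    linarith
  have hsub := (subset_closedBall_of_tailRadius_eq_zero hn hΩ hT (by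
    have := mul_nonneg (show 0 ≤ 2 * (1 + A) by positivity)
      (tailRadius_nonneg (T := T) (w := w) (2 * d))
    linarith) hzero).trans (closedBall_subset_closedBall hR)
  calc diam T ≤ diam (closedBall w ((2 + 2 * (1 + A) * G) * d)) :=
        diam_mono hsub isBounded_closedBall
    _ ≤ 2 * ((2 + 2 * (1 + A) * G) * d) := diam_closedBall (by positivity)
    _ = 2 * (2 + 2 * (1 + A) * G) * d := by ring
    _ ≤ _ := mul_le_mul_of_nonneg_right (le_max_left _ _) hd.le
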